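/- Conventions. Banach spaces are real or complex, an operator is a bounded linear map, $B_X$ is the closed unit ball of $X$, $X^*$ is the dual of $X$, and $T^*\colon Y^*\to X^*$ is the dual operator of $T\colon X\to Y$. For a bounded sequence $(y_n)$ in a Banach space put $$\operatorname{ca}\big((y_n)\big)=\inf_{n}\sup\{\|y_k-y_l\|:\ k,l\ge n\},$$ and for an operator $T\colon X\to Y$ between Banach spaces put $$\operatorname{uc}(T)=\sup\Big\{\operatorname{ca}\Big(\Big(\sum_{i=1}^n Tx_i\Big)_n\Big):\ (x_n)\subset X,\ \sup_{x^*\in B_{X^*}}\sum_{n=1}^\infty|x^*(x_n)|\le 1\Big\}.$$ For a bounded subset $A$ of a Banach space $X$ let $$\omega(A)=\inf\Big\{\sup_{a\in A}\operatorname{dist}(a,K):\ \emptyset\ne K\subset X\text{ weakly compact}\Big\},$$ $$\gamma(A)=\sup\Big\{\big|\lim_n\lim_m x_m^*(x_n)-\lim_m\lim_n x_m^*(x_n)\big|:\ (x_n)\subset A,\ (x_m^*)\subset B_{X^*},\ \text{the limits exist}\Big\},$$ and for an operator $T\colon X\to Y$ write $\omega(T)=\omega(T(B_X))$ and $\gamma(T)=\gamma(T(B_X))$.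 Theorem. Let $\Omega$ be a locally compact Hausdorff space, and let $C_0(\Omega)$ be the Banach space, with the supremum norm, of the continuous scalar functions on $\Omega$ that vanish at infinity. (a) If the scalars are complex, then for every complex Banach space $Y$ and every operator $T\colon C_0(\Omega)\to Y$, $$\omega(T^*)\le \pi\operatorname{uc}(T).$$ (b) If the scalars are real, then for every real Banach space $Y$ and every operator $T\colon C_0(\Omega)\to Y$, $$\omega(T^*)\le 2\operatorname{uc}(T).$$ (c) Consequently, in both cases $C_0(\Omega)$ has the quantitative property (V) in the $\omega^*$ form and in the $\gamma$ form: there is a constant $C>0$ such that $\omega(T^*)\le C\operatorname{uc}(T)$ for every Banach space $Y$ (over the same scalars) and every operator $T\colon C_0(\Omega)\to Y$, and there is a constant $C>0$ such that $\gamma(T)\le C\operatorname{uc}(T)$ for all such $Y$ and $T$. -/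

import Mathlib

open Filter Topology
open scoped ENNReal ZeroAtInfty

universe u v

namespace QuantV

noncomputable section

/-- Measure of non-Cauchyness of a sequence:
`ca (x_n) = inf_n sup {‖x_k - x_l‖ : k, l ≥ n}`, as an extended nonnegative real. -/
def ca {E : Type*} [NormedAddCommGroup E] (x : ℕ → E) : ℝ≥0∞ :=
  ⨅ n : ℕ, ⨆ k : ℕ, ⨆ l : ℕ, ⨆ (_ : n ≤ k) (_ : n ≤ l), ‖x k - x l‖ₑ

/-- `sup_{f ∈ B_{X*}} ∑_n |f (x_n)| ≤ 1` for the sequence `x` in `X`. -/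
def IsNormalizedWUC (𝕜 : Type*) [RCLike 𝕜] {X : Type*} [NormedAddCommGroup X] [NormedSpace 𝕜 X]
    (x : ℕ → X) : Prop :=
  (⨆ f ∈ Metric.closedBall (0 : StrongDual 𝕜 X) 1, ∑' n : ℕ, ‖f (x n)‖ₑ) ≤ 1

/-- `uc(T)`: how far the operator `T` is from being unconditionally converging. It is the supremum
of `ca` of the sequence of partial sums of `∑ T x_n`, over all sequences `(x_n)` in `X` with
`sup_{f ∈ B_{X*}} ∑_n |f (x_n)| ≤ 1`. -/
def uc {𝕜 : Type*} [RCLike 𝕜] {X Y : Type*} [NormedAddCommGroup X] [NormedSpace 𝕜 X]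
    [NormedAddCommGroup Y] [NormedSpace 𝕜 Y] (T : X →L[𝕜] Y) : ℝ≥0∞ :=
  ⨆ (x : ℕ → X) (_ : IsNormalizedWUC 𝕜 x), ca (fun n => ∑ i ∈ Finset.range (n + 1), T (x i))

/-- The non-symmetrized Hausdorff distance `sup {dist (a, B) : a ∈ A}` from `A` to `B`. -/
def excess {E : Type*} [NormedAddCommGroup E] (A B : Set E) : ℝ≥0∞ :=
  ⨆ a ∈ A, Metric.infEDist a B

/-- Compactness in the weak topology of the normed space `E`. -/
def IsWeaklyCompact (𝕜 : Type*) [RCLike 𝕜] {E : Type*} [NormedAddCommGroup E] [NormedSpace 𝕜 E]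
    (K : Set E) : Prop :=
  IsCompact (toWeakSpace 𝕜 E '' K)

/-- The de Blasi measure of weak non-compactness of the set `A`. -/
def omegaSet (𝕜 : Type*) [RCLike 𝕜] {E : Type*} [NormedAddCommGroup E] [NormedSpace 𝕜 E]
    (A : Set E) : ℝ≥0∞ :=
  ⨅ (K : Set E) (_ : K.Nonempty) (_ : IsWeaklyCompact 𝕜 K), excess A K

/-- The iterated limit `lim_n lim_m a n m` exists (all inner limits and the outer one)
and equals `L`. -/
def HasIteratedLimit {𝕜 : Type*} [RCLike 𝕜] (a : ℕ → ℕ → 𝕜) (L : 𝕜) : Prop :=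
  ∃ b : ℕ → 𝕜, (∀ n, Tendsto (fun m => a n m) atTop (𝓝 (b n))) ∧ Tendsto b atTop (𝓝 L)

/-- The measure of weak non-compactness given by the double limit criterion:
the supremum of `|lim_n lim_m f_m (x_n) - lim_m lim_n f_m (x_n)|` over sequences `(x_n)` in `A` and
`(f_m)` in the closed unit ball of the dual for which these limits exist. -/
def gammaSet (𝕜 : Type*) [RCLike 𝕜] {E : Type*} [NormedAddCommGroup E] [NormedSpace 𝕜 E]
    (A : Set E) : ℝ≥0∞ :=
  ⨆ (x : ℕ → E) (f : ℕ → StrongDual 𝕜 E) (L : 𝕜) (M : 𝕜)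
    (_ : ∀ n, x n ∈ A) (_ : ∀ m, f m ∈ Metric.closedBall (0 : StrongDual 𝕜 E) 1)
    (_ : HasIteratedLimit (fun n m => f m (x n)) L)
    (_ : HasIteratedLimit (fun m n => f m (x n)) M), ‖L - M‖ₑ

section Operators

variable {𝕜 : Type*} [RCLike 𝕜] {X Y : Type*} [NormedAddCommGroup X] [NormedSpace 𝕜 X]
  [NormedAddCommGroup Y] [NormedSpace 𝕜 Y]

/-- `ω(T) = ω(T(B_X))`. -/
def omega (T : X →L[𝕜] Y) : ℝ≥0∞ := omegaSet 𝕜 (T '' Metric.closedBall 0 1)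

/-- `γ(T) = γ(T(B_X))`. -/
def gamma (T : X →L[𝕜] Y) : ℝ≥0∞ := gammaSet 𝕜 (T '' Metric.closedBall 0 1)

/-- The dual operator `T* : Y* → X*`, `T* g = g ∘ T`. -/
def dualOp (T : X →L[𝕜] Y) : StrongDual 𝕜 Y →L[𝕜] StrongDual 𝕜 X :=
  ContinuousLinearMap.precomp 𝕜 T

end Operators

/-- The quantitative property (V), γ form: for some constant `C > 0`, `γ(T) ≤ C · uc(T)` for
every Banach space `Y` and every operator `T : X → Y`. -/
def HasQuantV.{w, z} (𝕜 : Type*) [RCLike 𝕜] (X : Type z) [NormedAddCommGroup X]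
    [NormedSpace 𝕜 X] : Prop :=
  ∃ C : ℝ, 0 < C ∧ ∀ (Y : Type w) [NormedAddCommGroup Y] [NormedSpace 𝕜 Y] [CompleteSpace Y]
    (T : X →L[𝕜] Y), gamma T ≤ ENNReal.ofReal C * uc T

/-- The quantitative property (V), ω* form: for some constant `C > 0`, `ω(T*) ≤ C · uc(T)` for
every Banach space `Y` and every operator `T : X → Y`. -/
def HasQuantVOmegaStar.{w, z} (𝕜 : Type*) [RCLike 𝕜] (X : Type z) [NormedAddCommGroup X]
    [NormedSpace 𝕜 X] : Prop :=
  ∃ C : ℝ, 0 < C ∧ ∀ (Y : Type w) [NormedAddCommGroup Y] [NormedSpace 𝕜 Y] [CompleteSpace Y]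
    (T : X →L[𝕜] Y), omega (dualOp T) ≤ ENNReal.ofReal C * uc T

end

end QuantV

namespace QuantV

/-! ### Weak compactness, double limits and factorization through a Hilbert space. -/

section WeakCompactness

variable {𝕜 : Type*} [RCLike 𝕜] {X Y : Type*} [NormedAddCommGroup X] [NormedSpace 𝕜 X]
  [NormedAddCommGroup Y] [NormedSpace 𝕜 Y]

/-! The constant is in fact one: `omega_dualOp_le_uc`. Suppose A = T*(B_{Y*}) has measure of weak
noncompactness above δ. For each finite measure μ, the functionals factoring through C₀(Ω) → L²(μ)
with norm at most R form a weakly compact set, so some φ in A is farther than δ from it. Hahn–Banach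
(`exists_decomposition_of_norm_le_add`) then gives k in the unit ball with |φ(k)| > δ and L²(μ)-norm
at most 1: this is `IsSingularlyLarge`.

From this, a sequence with ∑|fₙ| ≤ 1 and |φₙ(fₙ)| > δ' for suitable φₙ in A is built for any δ' < δ.
Put fₙ = uₙgₙ and uₙ₊₁ = uₙ(1 - |gₙ|). A pigeonhole argument (`IsSingularlyLarge.exists_step`)
chooses gₙ so that singular largeness survives multiplication by 1 - |gₙ|. The series ∑ fₙ is
normalized weakly unconditionally Cauchy and ‖T fₙ‖ > δ', hence uc(T) ≥ δ'.

The γ form follows since γ(T) ≤ 2ω(T*). -/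

theorem norm_sub_le_of_tendsto {ι : Type*} {l : Filter ι} [l.NeBot] {a b : ι → 𝕜} {x y : 𝕜} {r : ℝ}
    (ha : Tendsto a l (𝓝 x)) (hb : Tendsto b l (𝓝 y)) (h : ∀ i, ‖a i - b i‖ ≤ r) :
    ‖x - y‖ ≤ r :=
  le_of_tendsto (ha.sub hb).norm (Eventually.of_forall h)

/-- If the functionals `f m` lie within `r` of a weakly compact set, then the iterated limits of
`f m (z n)`, for `z` bounded by `1`, differ by at most `2 * r`. -/
theorem norm_iteratedLimit_sub_le {K : Set (StrongDual 𝕜 X)} (hK : IsWeaklyCompact 𝕜 K)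
    {z : ℕ → X} (hz : ∀ n, ‖z n‖ ≤ 1) {f κ : ℕ → StrongDual 𝕜 X} (hκ : ∀ m, κ m ∈ K) {r : ℝ}
    (hr : ∀ m, ‖f m - κ m‖ ≤ r) {L M : 𝕜} (hL : HasIteratedLimit (fun n m => f m (z n)) L)
    (hM : HasIteratedLimit (fun m n => f m (z n)) M) : ‖L - M‖ ≤ 2 * r := by
  obtain ⟨b, hb, hbL⟩ := hL
  obtain ⟨c, hc, hcM⟩ := hM
  -- Limits along a free ultrafilter agree with the given ones, and they also exist for the
  -- approximants.
  set U : Ultrafilter ℕ := hyperfilter ℕ with hU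
  have hUle : (U : Filter ℕ) ≤ atTop := by
    rw [← Nat.cofinite_eq_atTop]; exact hyperfilter_le_cofinite
  have hest : ∀ m n, ‖f m (z n) - κ m (z n)‖ ≤ r := fun m n => by
    have h := (f m - κ m).le_opNorm (z n)
    have h2 : ‖f m - κ m‖ * ‖z n‖ ≤ r * 1 :=
      mul_le_mul (hr m) (hz n) (norm_nonneg _) ((norm_nonneg _).trans (hr m))
    simpa using h.trans h2
  -- the weak limit of `κ`
  obtain ⟨k, -, hk⟩ : ∃ k ∈ toWeakSpace 𝕜 (StrongDual 𝕜 X) '' K,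
      Tendsto (fun m => toWeakSpace 𝕜 (StrongDual 𝕜 X) (κ m)) U (𝓝 k) := by
    obtain ⟨k, hk, h⟩ := hK.ultrafilter_le_nhds
      (U.map (fun m => toWeakSpace 𝕜 (StrongDual 𝕜 X) (κ m)))
      (by
        rw [Ultrafilter.coe_map, le_principal_iff, mem_map]
        exact univ_mem' fun m => ⟨κ m, hκ m, rfl⟩)
    exact ⟨k, hk, h⟩
  obtain ⟨k, rfl⟩ := (toWeakSpace 𝕜 (StrongDual 𝕜 X)).surjective k
  have hkF : ∀ F : StrongDual 𝕜 (StrongDual 𝕜 X), Tendsto (fun m => F (κ m)) U (𝓝 (F k)) :=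
    fun F => ((WeakBilin.eval_continuous (topDualPairing 𝕜 (StrongDual 𝕜 X)).flip F).tendsto
      (toWeakSpace 𝕜 (StrongDual 𝕜 X) k)).comp hk
  -- the weak-star limit of `z` in the bidual
  obtain ⟨G, hG⟩ : ∃ G : StrongDual 𝕜 (StrongDual 𝕜 X),
      ∀ ψ : StrongDual 𝕜 X, Tendsto (fun n => ψ (z n)) U (𝓝 (G ψ)) := by
    obtain ⟨G, -, h⟩ := (WeakDual.isCompact_closedBall (𝕜 := 𝕜) (E := StrongDual 𝕜 X)
      (0 : StrongDual 𝕜 (StrongDual 𝕜 X)) 1).ultrafilter_le_nhds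
      (U.map (fun n => StrongDual.toWeakDual (NormedSpace.inclusionInDoubleDual 𝕜 X (z n))))
      (by
        rw [Ultrafilter.coe_map, le_principal_iff, mem_map]
        refine univ_mem' fun n => ?_
        simp only [Set.mem_preimage, mem_closedBall_zero_iff]
        exact (NormedSpace.double_dual_bound 𝕜 X (z n)).trans (hz n))
    refine ⟨WeakDual.toStrongDual G, fun ψ => ?_⟩
    have h' : Tendsto (fun n => StrongDual.toWeakDual
      (NormedSpace.inclusionInDoubleDual 𝕜 X (z n))) U (𝓝 G) := h
    exact ((WeakDual.eval_continuous ψ).tendsto G).comp h'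
  -- G(k) is within r of both iterated limits: weak convergence of `κ` tests against G as well as
  -- against each `z n`.
  have h1 : ‖L - G k‖ ≤ r := by
    refine norm_sub_le_of_tendsto (hbL.mono_left hUle) (hG k) fun n => ?_
    exact norm_sub_le_of_tendsto ((hb n).mono_left hUle)
      (hkF (NormedSpace.inclusionInDoubleDual 𝕜 X (z n))) fun m => hest m n
  have h2 : ‖M - G k‖ ≤ r := by
    refine norm_sub_le_of_tendsto (hcM.mono_left hUle) (hkF G) fun m => ?_
    exact norm_sub_le_of_tendsto ((hc m).mono_left hUle) (hG (κ m)) fun n => hest m n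
  calc ‖L - M‖ = ‖(L - G k) - (M - G k)‖ := by ring_nf
    _ ≤ ‖L - G k‖ + ‖M - G k‖ := norm_sub_le _ _
    _ ≤ 2 * r := by linarith

theorem gamma_le_two_mul_omega_dualOp (T : X →L[𝕜] Y) : gamma T ≤ 2 * omega (dualOp T) := by
  unfold omega omegaSet
  rw [ENNReal.mul_iInf_of_ne (by simp) (by simp)]
  refine le_iInf fun K => ?_
  rw [ENNReal.mul_iInf_of_ne (by simp) (by simp)]
  refine le_iInf fun hne => ?_
  rw [ENNReal.mul_iInf_of_ne (by simp) (by simp)]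
  refine le_iInf fun hK => ?_
  refine iSup_le fun x => iSup_le fun f => iSup_le fun L => iSup_le fun M => iSup_le fun hx =>
    iSup_le fun hf => iSup_le fun hL => iSup_le fun hM => ?_
  set e := excess (dualOp T '' Metric.closedBall 0 1) K with he
  refine ENNReal.le_of_forall_pos_le_add fun ε hε htop => ?_
  have he_top : e ≠ ⊤ := by
    rintro h; rw [h] at htop; simp at htop
  lift e to NNReal using he_top with e' he'
  choose z hz hzx using hx
  have hκ : ∀ m, ∃ k ∈ K, ‖dualOp T (f m) - k‖ ≤ (e' + ε / 2 : NNReal) := fun m => by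
    have h1 : Metric.infEDist (dualOp T (f m)) K ≤ e' := by
      rw [he]
      exact le_iSup₂_of_le (dualOp T (f m)) ⟨f m, hf m, rfl⟩ le_rfl
    have h2 : Metric.infEDist (dualOp T (f m)) K < ((e' + ε / 2 : NNReal) : ℝ≥0∞) :=
      h1.trans_lt (by exact_mod_cast lt_add_of_pos_right e' (half_pos hε))
    obtain ⟨k, hk, hlt⟩ := Metric.infEDist_lt_iff.1 h2
    refine ⟨k, hk, ?_⟩
    rw [edist_eq_enorm_sub, ← ofReal_norm, ENNReal.ofReal_lt_coe_iff (norm_nonneg _)] at hlt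
    exact hlt.le
  choose κ hκK hκr using hκ
  have hxz : ∀ m n, f m (x n) = dualOp T (f m) (z n) := fun m n => by rw [← hzx n]; rfl
  simp only [hxz] at hL hM
  have := norm_iteratedLimit_sub_le hK (fun n => by simpa using hz n) hκK hκr hL hM
  rw [← ofReal_norm]
  refine (ENNReal.ofReal_le_ofReal this).trans ?_
  have h3 : 2 * ((e' + ε / 2 : NNReal) : ℝ) = ((2 * e' + ε : NNReal) : ℝ) := by
    push_cast; ring
  rw [h3, ENNReal.ofReal_coe_nnreal]
  push_cast
  exact le_rfl

/-- The hypothesis makes φ a contractive functional of (δx, R Jx) in the ℓ¹-sum of X and H. A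
Hahn–Banach extension splits over the two coordinates: the second gives ψ, the first the remainder.
-/
theorem exists_decomposition_of_norm_le_add {H : Type*} [NormedAddCommGroup H]
    [NormedSpace 𝕜 H] (J : X →L[𝕜] H) {δ R : ℝ} (hδ : 0 < δ) (hR : 0 ≤ R)
    (φ : StrongDual 𝕜 X) (h : ∀ x, ‖φ x‖ ≤ δ * ‖x‖ + R * ‖J x‖) :
    ∃ ψ : StrongDual 𝕜 H, ‖ψ‖ ≤ R ∧ ‖φ - ψ.comp J‖ ≤ δ := by
  let A : X →ₗ[𝕜] WithLp 1 (X × H) :=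
    { toFun := fun x => WithLp.toLp 1 ((δ : 𝕜) • x, (R : 𝕜) • J x)
      map_add' := fun x y => WithLp.ofLp_injective 1 (by ext <;> simp)
      map_smul' := fun c x => WithLp.ofLp_injective 1 (by ext <;> simp [smul_comm c]) }
  have hA : ∀ x, ‖A x‖ = δ * ‖x‖ + R * ‖J x‖ := fun x => by
    rw [WithLp.prod_norm_eq_of_L1]
    simp [A, norm_smul, abs_of_pos hδ, abs_of_nonneg hR]
  have hinj : Function.Injective A := by
    rw [injective_iff_map_eq_zero]
    intro x hx
    have h0 := hA x
    rw [hx, norm_zero] at h0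
    have : ‖x‖ = 0 := by
      nlinarith [norm_nonneg x, norm_nonneg (J x), mul_nonneg hR (norm_nonneg (J x)),
        mul_nonneg hδ.le (norm_nonneg x)]
    simpa using this
  let e := LinearEquiv.ofInjective A hinj
  let f : StrongDual 𝕜 (LinearMap.range A) :=
    LinearMap.mkContinuous (φ.toLinearMap.comp e.symm.toLinearMap) 1 (by
      intro y
      obtain ⟨x, rfl⟩ := e.surjective y
      simp only [LinearMap.coe_comp, LinearEquiv.coe_coe, Function.comp_apply,
        LinearEquiv.symm_apply_apply, one_mul]
      exact (h x).trans (hA x).ge)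
  have hf : ∀ x, f ⟨A x, ⟨x, rfl⟩⟩ = φ x := fun x => by
    have : (⟨A x, ⟨x, rfl⟩⟩ : LinearMap.range A) = e x := rfl
    rw [this]
    simp [f]
  have hf1 : ‖f‖ ≤ 1 := LinearMap.mkContinuous_norm_le _ zero_le_one _
  obtain ⟨Φ, hΦ, hΦn⟩ := exists_extension_norm_eq _ f
  have hΦ1 : ∀ y, ‖Φ y‖ ≤ ‖y‖ := fun y => by
    have := Φ.le_opNorm y
    rw [hΦn] at this
    exact this.trans (mul_le_of_le_one_left (norm_nonneg _) hf1)
  let ψ : StrongDual 𝕜 H := LinearMap.mkContinuous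
    { toFun := fun w => Φ (WithLp.toLp 1 ((0 : X), (R : 𝕜) • w))
      map_add' := fun a b => by rw [← map_add]; congr 1; apply WithLp.ofLp_injective 1; ext <;> simp
      map_smul' := fun c a => by
        rw [RingHom.id_apply, ← map_smul]
        congr 1
        apply WithLp.ofLp_injective 1
        ext <;> simp [smul_comm c] } R (fun w => by
      refine (hΦ1 _).trans ?_
      rw [WithLp.prod_norm_eq_of_L1]
      simp [norm_smul, abs_of_nonneg hR])
  refine ⟨ψ, LinearMap.mkContinuous_norm_le _ hR _, ?_⟩
  refine ContinuousLinearMap.opNorm_le_bound _ hδ.le fun x => ?_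
  have : (φ - ψ.comp J) x = Φ (WithLp.toLp 1 ((δ : 𝕜) • x, (0 : H))) := by
    have h1 : φ x = Φ (A x) := by rw [← hf x, ← hΦ]
    have h2 : A x = WithLp.toLp 1 ((δ : 𝕜) • x, (0 : H))
        + WithLp.toLp 1 ((0 : X), (R : 𝕜) • J x) := by
      apply WithLp.ofLp_injective 1
      ext <;> simp [A]
    rw [sub_apply, h1, h2, map_add]
    simp [ψ]
  rw [this]
  refine (hΦ1 _).trans ?_
  rw [WithLp.prod_norm_eq_of_L1]
  simp [norm_smul, abs_of_pos hδ]

variable {H : Type*} [NormedAddCommGroup H] [InnerProductSpace 𝕜 H] [CompleteSpace H]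

/-- Hilbert spaces are reflexive. -/
theorem exists_eval_eq_of_bidual (F : StrongDual 𝕜 (StrongDual 𝕜 H)) :
    ∃ v : H, ∀ ψ : StrongDual 𝕜 H, F ψ = ψ v := by
  let D := InnerProductSpace.toDual 𝕜 H
  let c : StrongDual 𝕜 H := LinearMap.mkContinuous
    { toFun := fun g => star (F (D g))
      map_add' := fun a b => by simp
      map_smul' := fun a b => by simp [D.map_smulₛₗ] } ‖F‖ (fun g => by
        simpa using F.le_opNorm (D g))
  refine ⟨D.symm c, fun ψ => ?_⟩
  have h1 : inner 𝕜 (D.symm c) (D.symm ψ) = star (F ψ) := by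
    rw [InnerProductSpace.toDual_symm_apply]
    simp [c]
  have h2 : inner 𝕜 (D.symm ψ) (D.symm c) = ψ (D.symm c) :=
    InnerProductSpace.toDual_symm_apply
  rw [← h2, ← inner_conj_symm, h1]
  simp

/-- Reflexivity of H makes ψ ↦ ψ ∘ J weak*-to-weak continuous, so Banach–Alaoglu applies. -/
theorem isWeaklyCompact_image_comp_closedBall (J : X →L[𝕜] H) (R : ℝ) :
    IsWeaklyCompact 𝕜 ((fun ψ : StrongDual 𝕜 H => ψ.comp J) '' Metric.closedBall 0 R) := by
  have hc : Continuous (fun ψ : WeakDual 𝕜 H =>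
      toWeakSpace 𝕜 (StrongDual 𝕜 X) ((WeakDual.toStrongDual ψ).comp J)) := by
    refine WeakBilin.continuous_of_continuous_eval _ fun F => ?_
    obtain ⟨v, hv⟩ := exists_eval_eq_of_bidual
      (F.comp (ContinuousLinearMap.precomp 𝕜 J : StrongDual 𝕜 H →L[𝕜] StrongDual 𝕜 X))
    have : (fun ψ : WeakDual 𝕜 H => F ((WeakDual.toStrongDual ψ).comp J)) = fun ψ => ψ v := by
      funext ψ; exact hv (WeakDual.toStrongDual ψ)
    exact this ▸ WeakDual.eval_continuous v
  have hcomp := (WeakDual.isCompact_closedBall (𝕜 := 𝕜) (E := H) 0 R).image hc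
  unfold IsWeaklyCompact
  convert hcomp using 1
  ext y
  simp only [Set.mem_image, Set.mem_preimage, exists_exists_and_eq_and]
  constructor
  · rintro ⟨ψ, hψ, rfl⟩
    exact ⟨StrongDual.toWeakDual ψ, hψ, rfl⟩
  · rintro ⟨ψ, hψ, rfl⟩
    exact ⟨WeakDual.toStrongDual ψ, hψ, rfl⟩

end WeakCompactness

/-! ### The total variation of a functional on C₀(Ω), via Riesz–Markov. -/

section Variation

open scoped NNReal BoundedContinuousFunction CompactlySupported
open MeasureTheory

variable {𝕜 : Type*} [RCLike 𝕜] {Ω : Type*} [TopologicalSpace Ω]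

theorem norm_apply_le_norm (f : C₀(Ω, 𝕜)) (x : Ω) : ‖f x‖ ≤ ‖f‖ :=
  f.toBCF.norm_coe_le_norm x

theorem norm_le_of_forall_apply {f : C₀(Ω, 𝕜)} {C : ℝ} (hC : 0 ≤ C) (h : ∀ x, ‖f x‖ ≤ C) :
    ‖f‖ ≤ C :=
  (BoundedContinuousFunction.norm_le (f := f.toBCF) hC).2 h

/-- The product of a bounded continuous real function and a function vanishing at infinity. -/
noncomputable def bmul (u : Ω →ᵇ ℝ) (k : C₀(Ω, 𝕜)) : C₀(Ω, 𝕜) where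
  toFun x := u x • k x
  continuous_toFun := by fun_prop
  zero_at_infty' := by
    refine squeeze_zero_norm (a := fun x => ‖u‖ * ‖k x‖) (fun x => ?_) ?_
    · rw [norm_smul]
      exact mul_le_mul_of_nonneg_right (u.norm_coe_le_norm x) (norm_nonneg _)
    · simpa using (zero_at_infty k).norm.const_mul ‖u‖

@[simp]
theorem bmul_apply (u : Ω →ᵇ ℝ) (k : C₀(Ω, 𝕜)) (x : Ω) : bmul u k x = u x • k x := rfl

theorem exists_norm_le_one_mul_eq (z : 𝕜) : ∃ θ : 𝕜, ‖θ‖ ≤ 1 ∧ θ * z = (‖z‖ : 𝕜) := by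
  by_cases hz : z = 0
  · exact ⟨0, by simp, by simp [hz]⟩
  · have h : (‖z‖ : 𝕜) ≠ 0 := by simpa using hz
    refine ⟨(‖z‖ : 𝕜)⁻¹ * star z, ?_, ?_⟩
    · simp [norm_mul, hz]
    · rw [mul_assoc]
      have : star z * z = (‖z‖ : 𝕜) ^ 2 := RCLike.conj_mul z
      rw [this]
      field_simp

/-- The variation of a functional on `C₀(Ω, 𝕜)`, evaluated at a nonnegative compactly supported
function. -/
noncomputable def variation (φ : StrongDual 𝕜 C₀(Ω, 𝕜)) (f : C_c(Ω, ℝ≥0)) : ℝ≥0 :=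
  sSup {r | ∃ g : C₀(Ω, 𝕜), (∀ x, ‖g x‖₊ ≤ f x) ∧ ‖φ g‖₊ = r}

variable (φ : StrongDual 𝕜 C₀(Ω, 𝕜))

theorem nnnorm_apply_le_variation {f : C_c(Ω, ℝ≥0)} {g : C₀(Ω, 𝕜)} (h : ∀ x, ‖g x‖₊ ≤ f x) :
    ‖φ g‖₊ ≤ variation φ f := by
  refine le_csSup ?_ ⟨g, h, rfl⟩
  obtain ⟨C, hC⟩ := (f.hasCompactSupport.comp_left (g := NNReal.toReal)
    rfl).exists_bound_of_continuous (by fun_prop)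
  refine ⟨‖φ‖₊ * Real.toNNReal (max C 0), ?_⟩
  rintro _ ⟨g, hg, rfl⟩
  refine (φ.le_opNNNorm g).trans (mul_le_mul_of_nonneg_left ?_ zero_le)
  rw [← NNReal.coe_le_coe, coe_nnnorm, Real.coe_toNNReal _ (le_max_right _ _)]
  refine norm_le_of_forall_apply (le_max_right _ _) fun x => ?_
  have h1 : ‖g x‖ ≤ f x := hg x
  have h2 : (f x : ℝ) ≤ C := (le_abs_self _).trans (hC x)
  exact (h1.trans h2).trans (le_max_left _ _)

variable {φ}

theorem variation_le {f : C_c(Ω, ℝ≥0)} {c : ℝ≥0}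
    (h : ∀ g : C₀(Ω, 𝕜), (∀ x, ‖g x‖₊ ≤ f x) → ‖φ g‖₊ ≤ c) : variation φ f ≤ c := by
  refine csSup_le ⟨0, 0, fun x => by simp, by simp⟩ ?_
  rintro _ ⟨g, hg, rfl⟩
  exact h g hg

variable (φ)

/-- Split g using the weights fᵢ/(f₁ + f₂ + η); the η avoids division by zero and leaves a remainder
of norm at most η. -/
theorem variation_add_le (f₁ f₂ : C_c(Ω, ℝ≥0)) :
    variation φ (f₁ + f₂) ≤ variation φ f₁ + variation φ f₂ := by
  refine variation_le fun g hg => ?_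
  rw [← NNReal.coe_le_coe]
  refine le_of_forall_pos_le_add fun ε hε => ?_
  set η : ℝ := ε / (‖φ‖ + 1) with hη
  have hη0 : 0 < η := by positivity
  have hpos : ∀ x, 0 < (f₁ x : ℝ) + f₂ x + η := fun x => by positivity
  have hb : ∀ (f : C_c(Ω, ℝ≥0)), (∀ x, f x ≤ f₁ x + f₂ x) → ∀ x,
      ‖(f x : ℝ) / (f₁ x + f₂ x + η)‖ ≤ 1 := fun f hf x => by
    rw [Real.norm_of_nonneg (div_nonneg (f x).coe_nonneg (hpos x).le), div_le_one (hpos x)]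
    have : (f x : ℝ) ≤ f₁ x + f₂ x := hf x
    linarith
  let q (f : C_c(Ω, ℝ≥0)) (hf : ∀ x, f x ≤ f₁ x + f₂ x) : Ω →ᵇ ℝ :=
    BoundedContinuousFunction.ofNormedAddCommGroup (fun x => (f x : ℝ) / (f₁ x + f₂ x + η))
      (by
        refine Continuous.div (by fun_prop) (by fun_prop) fun x => (hpos x).ne') 1 (hb f hf)
  have hdom : ∀ f hf x, ‖bmul (q f hf) g x‖₊ ≤ f x := fun f hf x => by
    rw [← NNReal.coe_le_coe, coe_nnnorm, bmul_apply, norm_smul]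
    have h1 : ‖g x‖ ≤ (f₁ x : ℝ) + f₂ x := hg x
    change ‖(f x : ℝ) / (f₁ x + f₂ x + η)‖ * ‖g x‖ ≤ f x
    rw [Real.norm_of_nonneg (div_nonneg (f x).coe_nonneg (hpos x).le), div_mul_eq_mul_div,
      div_le_iff₀ (hpos x)]
    exact mul_le_mul_of_nonneg_left (by linarith) (f x).coe_nonneg
  have hf₁ : ∀ x, f₁ x ≤ f₁ x + f₂ x := fun x => le_self_add
  have hf₂ : ∀ x, f₂ x ≤ f₁ x + f₂ x := fun x => le_add_self
  set g₁ := bmul (q f₁ hf₁) g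
  set g₂ := bmul (q f₂ hf₂) g
  have h1 : ‖φ g₁‖ ≤ variation φ f₁ := nnnorm_apply_le_variation φ (hdom f₁ hf₁)
  have h2 : ‖φ g₂‖ ≤ variation φ f₂ := nnnorm_apply_le_variation φ (hdom f₂ hf₂)
  have h3 : ‖g - g₁ - g₂‖ ≤ η := by
    refine norm_le_of_forall_apply hη0.le fun x => ?_
    have hx := hpos x
    have : (g - g₁ - g₂) x = (η / (f₁ x + f₂ x + η)) • g x := by
      change g x - ((f₁ x : ℝ) / (f₁ x + f₂ x + η)) • g x
        - ((f₂ x : ℝ) / (f₁ x + f₂ x + η)) • g x = _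
      rw [sub_sub, ← add_smul, ← add_div]
      nth_rw 1 [← one_smul ℝ (g x)]
      rw [← sub_smul]
      congr 1
      field_simp
      ring
    have h1 : ‖g x‖ ≤ (f₁ x : ℝ) + f₂ x := hg x
    rw [this, norm_smul, Real.norm_of_nonneg (div_nonneg hη0.le hx.le), div_mul_eq_mul_div,
      div_le_iff₀ hx]
    exact mul_le_mul_of_nonneg_left (by linarith) hη0.le
  have h4 : ‖φ (g - g₁ - g₂)‖ ≤ ε := by
    refine (φ.le_opNorm _).trans ((mul_le_mul_of_nonneg_left h3 (norm_nonneg _)).trans ?_)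
    rw [hη, ← mul_div_assoc, div_le_iff₀ (by positivity)]
    nlinarith [norm_nonneg φ]
  have h5 : φ g = φ g₁ + φ g₂ + φ (g - g₁ - g₂) := by
    rw [map_sub, map_sub]; ring
  rw [coe_nnnorm, h5]
  push_cast
  exact norm_add₃_le.trans (by linarith)

/-- Rotating g₁ and g₂ by scalars makes φ(g₁) and φ(g₂) nonnegative, so that their absolute values
add. -/
theorem add_variation_le (f₁ f₂ : C_c(Ω, ℝ≥0)) :
    variation φ f₁ + variation φ f₂ ≤ variation φ (f₁ + f₂) := by
  have key : ∀ g₁ g₂ : C₀(Ω, 𝕜), (∀ x, ‖g₁ x‖₊ ≤ f₁ x) → (∀ x, ‖g₂ x‖₊ ≤ f₂ x) →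
      ‖φ g₁‖₊ + ‖φ g₂‖₊ ≤ variation φ (f₁ + f₂) := fun g₁ g₂ h₁ h₂ => by
    obtain ⟨θ₁, hθ₁, e₁⟩ := exists_norm_le_one_mul_eq (φ g₁)
    obtain ⟨θ₂, hθ₂, e₂⟩ := exists_norm_le_one_mul_eq (φ g₂)
    have h : ‖φ (θ₁ • g₁ + θ₂ • g₂)‖₊ ≤ variation φ (f₁ + f₂) := by
      refine nnnorm_apply_le_variation φ fun x => ?_
      refine (nnnorm_add_le _ _).trans (add_le_add ?_ ?_)
      · refine le_trans ?_ (h₁ x)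
        change ‖θ₁ • g₁ x‖₊ ≤ _
        rw [nnnorm_smul]
        exact mul_le_of_le_one_left zero_le hθ₁
      · refine le_trans ?_ (h₂ x)
        change ‖θ₂ • g₂ x‖₊ ≤ _
        rw [nnnorm_smul]
        exact mul_le_of_le_one_left zero_le hθ₂
    rw [map_add, map_smul, map_smul, smul_eq_mul, smul_eq_mul, e₁, e₂, ← RCLike.ofReal_add] at h
    rw [← NNReal.coe_le_coe] at h ⊢
    rwa [coe_nnnorm, RCLike.norm_ofReal, abs_of_nonneg (by positivity)] at h
  have h1 : ∀ g₂ : C₀(Ω, 𝕜), (∀ x, ‖g₂ x‖₊ ≤ f₂ x) →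
      variation φ f₁ + ‖φ g₂‖₊ ≤ variation φ (f₁ + f₂) := fun g₂ h₂ => by
    refine add_le_of_le_tsub_right_of_le ?_ (variation_le fun g₁ h₁ =>
      le_tsub_of_add_le_right (key g₁ g₂ h₁ h₂))
    exact le_add_self.trans (key 0 g₂ (fun x => by simp) h₂)
  refine add_le_of_le_tsub_left_of_le ?_ (variation_le fun g₂ h₂ =>
      le_tsub_of_add_le_left (h1 g₂ h₂))
  exact le_self_add.trans (h1 0 (fun x => by simp))

theorem variation_smul_le (c : ℝ≥0) (hc : c ≠ 0) (f : C_c(Ω, ℝ≥0)) :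
    variation φ (c • f) ≤ c * variation φ f := by
  refine variation_le fun g hg => ?_
  have h : ‖φ ((((c⁻¹ : ℝ≥0) : ℝ) : 𝕜) • g)‖₊ ≤ variation φ f := by
    refine nnnorm_apply_le_variation φ fun x => ?_
    have hx : ‖g x‖₊ ≤ c * f x := hg x
    change ‖(((c⁻¹ : ℝ≥0) : ℝ) : 𝕜) • g x‖₊ ≤ f x
    rw [nnnorm_smul]
    have : ‖(((c⁻¹ : ℝ≥0) : ℝ) : 𝕜)‖₊ = c⁻¹ := by ext; simp
    rw [this]
    exact (inv_mul_le_iff₀ (pos_iff_ne_zero.2 hc)).2 hx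
  rw [map_smul, nnnorm_smul] at h
  have : ‖(((c⁻¹ : ℝ≥0) : ℝ) : 𝕜)‖₊ = c⁻¹ := by ext; simp
  rw [this] at h
  exact (inv_mul_le_iff₀ (pos_iff_ne_zero.2 hc)).1 h

/-- The variation of a functional as a positive linear functional. -/
noncomputable def variationLinear : C_c(Ω, ℝ≥0) →ₗ[ℝ≥0] ℝ≥0 where
  toFun := variation φ
  map_add' f₁ f₂ := le_antisymm (variation_add_le φ f₁ f₂) (add_variation_le φ f₁ f₂)
  map_smul' c f := by
    by_cases hc : c = 0
    · subst hc
      simp only [zero_smul, RingHom.id_apply]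
      refine le_antisymm (variation_le fun g hg => ?_) zero_le
      have : g = 0 := by
        ext x
        have h0 : ‖g x‖₊ ≤ 0 := hg x
        simpa using h0
      simp [this]
    · refine le_antisymm (variation_smul_le φ c hc f) ?_
      -- The reverse inequality is the same one for c⁻¹ and c • f.
      have h := variation_smul_le φ c⁻¹ (inv_ne_zero hc) (c • f)
      rw [inv_smul_smul₀ hc] at h
      exact (le_inv_mul_iff₀ (pos_iff_ne_zero.2 hc)).1 h

/-- The measure represents the variation. Urysohn functions bound its mass by ‖φ‖, and truncation
carries the estimate from compact supports to C₀(Ω). -/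
theorem exists_isFiniteMeasure_enorm_apply_le [T2Space Ω] [LocallyCompactSpace Ω]
    [MeasurableSpace Ω] [BorelSpace Ω] :
    ∃ μ : Measure Ω, IsFiniteMeasure μ ∧ ∀ f : C₀(Ω, 𝕜), ‖φ f‖ₑ ≤ ∫⁻ x, ‖f x‖ₑ ∂μ := by
  set μ := NNRealRMK.rieszMeasure (variationLinear φ) with hμ
  have hint : ∀ p : C_c(Ω, ℝ≥0), ∫⁻ x, p x ∂μ = variation φ p := fun p =>
    NNRealRMK.lintegral_rieszMeasure (variationLinear φ) p
  refine ⟨μ, ⟨?_⟩, fun f => ?_⟩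
  · suffices h : μ Set.univ ≤ (‖φ‖₊ : ℝ≥0∞) from h.trans_lt ENNReal.coe_lt_top
    rw [isOpen_univ.measure_eq_iSup_isCompact]
    refine iSup₂_le fun K _ => iSup_le fun hK => ?_
    obtain ⟨e, he1, -, hec, he01⟩ := exists_continuous_one_zero_of_isCompact hK
      (isClosed_empty (X := Ω)) (Set.disjoint_empty K)
    let p : C_c(Ω, ℝ≥0) := CompactlySupportedContinuousMap.nnrealPart ⟨e, hec⟩
    have hp : ∀ x, p x = Real.toNNReal (e x) := fun x => rfl
    calc μ K = ∫⁻ x, K.indicator 1 x ∂μ := (lintegral_indicator_one hK.measurableSet).symm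
      _ ≤ ∫⁻ x, p x ∂μ := by
        refine lintegral_mono fun x => ?_
        by_cases hx : x ∈ K
        · simp [hx, hp, he1 hx]
        · simp [hx]
      _ = variation φ p := hint p
      _ ≤ ‖φ‖₊ := by
        rw [ENNReal.coe_le_coe]
        refine variation_le fun g hg => ?_
        have hg1 : ‖g‖ ≤ 1 := norm_le_of_forall_apply zero_le_one fun x => by
          have h1 : ‖g x‖₊ ≤ Real.toNNReal (e x) := hg x
          have h2 : Real.toNNReal (e x) ≤ 1 := Real.toNNReal_le_one.2 (he01 x).2
          exact h1.trans h2
        exact (φ.le_opNorm g).trans (mul_le_of_le_one_right (norm_nonneg _) hg1)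
  · refine ENNReal.le_of_forall_pos_le_add fun ε hε _ => ?_
    set η : ℝ := ε / (2 * (‖φ‖ + 1)) with hη
    have hη0 : 0 < η := by positivity
    -- This cutoff is 0 where |f| ≤ η and 1 where |f| ≥ 2η, so e f has compact support and lies
    -- within 2η of f.
    let e0 : Ω → ℝ := fun x => min 1 (max (‖f x‖ / η - 1) 0)
    have he0 : ∀ x, 0 ≤ e0 x := fun x => le_min zero_le_one (le_max_right _ _)
    have he1 : ∀ x, e0 x ≤ 1 := fun x => min_le_left _ _
    have hec : Continuous e0 := by fun_prop
    let e : Ω →ᵇ ℝ := BoundedContinuousFunction.ofNormedAddCommGroup e0 hec 1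
      fun x => by rw [Real.norm_of_nonneg (he0 x)]; exact he1 x
    have hsupp : HasCompactSupport (fun x => ‖bmul e f x‖₊) := by
      have h1 : ∀ᶠ x in cocompact Ω, ‖f x‖ < η := by
        simpa using (zero_at_infty f).norm.eventually (gt_mem_nhds (by simpa using hη0))
      obtain ⟨t, ht, hts⟩ := mem_cocompact.1 h1
      refine HasCompactSupport.intro ht fun x hx => ?_
      have h2 : ‖f x‖ < η := hts hx
      have h3 : e x = 0 := by
        change min 1 (max (‖f x‖ / η - 1) 0) = 0
        rw [max_eq_right, min_eq_right zero_le_one]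
        rw [sub_nonpos, div_le_one hη0]
        exact h2.le
      simp [h3]
    let p : C_c(Ω, ℝ≥0) := ⟨⟨fun x => ‖bmul e f x‖₊, by fun_prop⟩, hsupp⟩
    have h1 : (‖φ (bmul e f)‖₊ : ℝ≥0∞) ≤ ∫⁻ x, ‖f x‖ₑ ∂μ := by
      calc (‖φ (bmul e f)‖₊ : ℝ≥0∞) ≤ variation φ p :=
            ENNReal.coe_le_coe.2 (nnnorm_apply_le_variation φ fun x => le_rfl)
        _ = ∫⁻ x, p x ∂μ := (hint p).symm
        _ ≤ _ := by
          refine lintegral_mono fun x => ?_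
          change ((‖e x • f x‖₊ : ℝ≥0) : ℝ≥0∞) ≤ (‖f x‖₊ : ℝ≥0)
          rw [ENNReal.coe_le_coe, nnnorm_smul]
          refine mul_le_of_le_one_left zero_le ?_
          exact (Real.norm_of_nonneg (he0 x)).trans_le (he1 x)
    have h2 : ‖f - bmul e f‖ ≤ 2 * η := by
      refine norm_le_of_forall_apply (by positivity) fun x => ?_
      have hx : (f - bmul e f) x = (1 - e0 x) • f x := by
        rw [sub_smul, one_smul]; rfl
      rw [hx, norm_smul, Real.norm_of_nonneg (sub_nonneg.2 (he1 x))]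
      by_cases hfx : ‖f x‖ ≤ 2 * η
      · exact (mul_le_of_le_one_left (norm_nonneg _) (by linarith [he0 x])).trans hfx
      · have : e0 x = 1 := by
          refine min_eq_left (le_max_of_le_left ?_)
          rw [le_sub_iff_add_le, le_div_iff₀ hη0]
          linarith
        rw [this]; simpa using hη0.le
    have h3 : ‖φ (f - bmul e f)‖₊ ≤ ε := by
      rw [← NNReal.coe_le_coe, coe_nnnorm]
      refine (φ.le_opNorm _).trans ((mul_le_mul_of_nonneg_left h2 (norm_nonneg _)).trans ?_)
      have : ‖φ‖ * (2 * η) = (ε : ℝ) * (‖φ‖ / (‖φ‖ + 1)) := by rw [hη]; field_simp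
      rw [this]
      refine mul_le_of_le_one_right ε.2 ((div_le_one (by positivity)).2 (by linarith))
    calc ‖φ f‖ₑ = ‖φ (bmul e f) + φ (f - bmul e f)‖ₑ := by rw [map_sub]; ring_nf
      _ ≤ ‖φ (bmul e f)‖ₑ + ‖φ (f - bmul e f)‖ₑ := enorm_add_le _ _
      _ ≤ _ := add_le_add h1 (ENNReal.coe_le_coe.2 h3)

end Variation

/-! ### Extraction of sequences with ∑|fₙ| ≤ 1 on which A stays large. -/

section DisjointSequences

open scoped NNReal BoundedContinuousFunction
open MeasureTheory

variable {𝕜 : Type*} [RCLike 𝕜] {Ω : Type*} [TopologicalSpace Ω]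

theorem sum_norm_apply_le {ι : Type*} (s : Finset ι) (φ : StrongDual 𝕜 C₀(Ω, 𝕜))
    (f : ι → C₀(Ω, 𝕜)) (hf : ∀ x, ∑ i ∈ s, ‖f i x‖ ≤ 1) : ∑ i ∈ s, ‖φ (f i)‖ ≤ ‖φ‖ := by
  choose θ hθ hθe using fun i => exists_norm_le_one_mul_eq (φ (f i))
  have h1 : ‖∑ i ∈ s, θ i • f i‖ ≤ 1 := by
    refine norm_le_of_forall_apply zero_le_one fun x => ?_
    have : (∑ i ∈ s, θ i • f i) x = ∑ i ∈ s, θ i • f i x := by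
      classical
      induction s using Finset.induction_on with
      | empty => simp
      | insert a s ha ih =>
        rw [Finset.sum_insert ha, Finset.sum_insert ha, ZeroAtInftyContinuousMap.add_apply,
          ih (fun x => le_trans (Finset.sum_le_sum_of_subset_of_nonneg (Finset.subset_insert a s)
            fun _ _ _ => norm_nonneg _) (hf x)), ZeroAtInftyContinuousMap.smul_apply]
    rw [this]
    refine (norm_sum_le _ _).trans (le_trans (Finset.sum_le_sum fun i _ => ?_) (hf x))
    rw [norm_smul]
    exact mul_le_of_le_one_left (norm_nonneg _) (hθ i)
  have h2 : φ (∑ i ∈ s, θ i • f i) = ((∑ i ∈ s, ‖φ (f i)‖ : ℝ) : 𝕜) := by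
    rw [map_sum]
    push_cast
    exact Finset.sum_congr rfl fun i _ => by rw [map_smul, smul_eq_mul, hθe]
  have h3 := φ.le_opNorm (∑ i ∈ s, θ i • f i)
  rw [h2, RCLike.norm_ofReal, abs_of_nonneg (Finset.sum_nonneg fun _ _ => norm_nonneg _)] at h3
  exact h3.trans (mul_le_of_le_one_right (norm_nonneg _) h1)

/-- The function `1 - |k|`. -/
noncomputable def oneSubNorm (k : C₀(Ω, 𝕜)) : Ω →ᵇ ℝ :=
  BoundedContinuousFunction.ofNormedAddCommGroup (fun x => 1 - ‖k x‖) (by fun_prop) (1 + ‖k‖)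
    fun x => by
      refine (norm_sub_le _ _).trans ?_
      rw [norm_one, norm_norm]
      exact add_le_add_right (norm_apply_le_norm k x) 1

@[simp]
theorem oneSubNorm_apply (k : C₀(Ω, 𝕜)) (x : Ω) : oneSubNorm k x = 1 - ‖k x‖ := rfl

/-- Integrate t ≤ s + t²/s with s μ(univ) ≤ η/2, and let ν be the multiple of μ that makes the
quadratic term at most η/2. No measurability of f is needed. -/
theorem exists_isFiniteMeasure_lintegral_le {α : Type*} [MeasurableSpace α] (μ : Measure α)
    [IsFiniteMeasure μ] {η : ℝ≥0} (hη : 0 < η) : ∃ ν : Measure α, IsFiniteMeasure ν ∧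
      ∀ f : α → ℝ≥0∞, ∫⁻ x, f x ^ 2 ∂ν ≤ 1 → ∫⁻ x, f x ∂μ ≤ η := by
  obtain ⟨s, hs0, hs⟩ : ∃ s : ℝ≥0, 0 < s ∧ (s : ℝ≥0∞) * μ Set.univ ≤ (η / 2 : ℝ≥0) := by
    refine ⟨η / 2 / (measureUnivNNReal μ + 1), by positivity, ?_⟩
    rw [← coe_measureUnivNNReal, ← ENNReal.coe_mul, ENNReal.coe_le_coe, div_mul_eq_mul_div]
    refine div_le_of_le_mul₀ zero_le zero_le ?_
    exact mul_le_mul_of_nonneg_left le_self_add zero_le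
  refine ⟨(2 * s⁻¹ * η⁻¹ : ℝ≥0) • μ, inferInstance, fun f hf => ?_⟩
  have hmain : ∀ t : ℝ≥0∞, t ≤ s + (s⁻¹ : ℝ≥0) * t ^ 2 := fun t => by
    induction t with
    | top => rw [show (⊤ : ℝ≥0∞) ^ 2 = ⊤ by simp, ENNReal.mul_top (by simpa using hs0.ne')]; simp
    | coe t =>
      norm_cast
      rw [← NNReal.coe_le_coe]
      push_cast
      have hs' : (0 : ℝ) < s := hs0
      rw [← sub_nonneg, show (s : ℝ) + (s : ℝ)⁻¹ * t ^ 2 - t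
        = ((s - t / 2) ^ 2 + 3 / 4 * (t : ℝ) ^ 2) / s by field_simp; ring]
      positivity
  have h2 : ((s⁻¹ : ℝ≥0) : ℝ≥0∞) * ∫⁻ x, f x ^ 2 ∂μ ≤ (η / 2 : ℝ≥0) := by
    rw [lintegral_smul_measure, ENNReal.smul_def, smul_eq_mul] at hf
    have := mul_le_mul_right hf ((η / 2 : ℝ≥0) : ℝ≥0∞)
    rw [← mul_assoc, ← ENNReal.coe_mul, mul_one] at this
    convert this using 3
    field_simp
  calc ∫⁻ x, f x ∂μ ≤ ∫⁻ x, (s + (s⁻¹ : ℝ≥0) * f x ^ 2) ∂μ := lintegral_mono fun x => hmain _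
    _ = s * μ Set.univ + (s⁻¹ : ℝ≥0) * ∫⁻ x, f x ^ 2 ∂μ := by
      rw [lintegral_add_left measurable_const, lintegral_const, lintegral_const_mul' _ _ (by simp)]
    _ ≤ (η / 2 : ℝ≥0) + (η / 2 : ℝ≥0) := add_le_add hs h2
    _ = η := by rw [← ENNReal.coe_add, add_halves]

variable [MeasurableSpace Ω] [BorelSpace Ω]

/-- A functional is uniformly small on functions dominated by functions small in a suitable
`L²`-seminorm. -/
theorem exists_isFiniteMeasure_norm_apply_le [T2Space Ω] [LocallyCompactSpace Ω]
    (φ : StrongDual 𝕜 C₀(Ω, 𝕜)) {η : ℝ} (hη : 0 < η) :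
    ∃ ν : Measure Ω, IsFiniteMeasure ν ∧ ∀ h h' : C₀(Ω, 𝕜), ∫⁻ x, ‖h x‖ₑ ^ 2 ∂ν ≤ 1 →
      (∀ x, ‖h' x‖ ≤ ‖h x‖) → ‖φ h'‖ ≤ η := by
  obtain ⟨μ, hμ, hφ⟩ := exists_isFiniteMeasure_enorm_apply_le φ
  lift η to ℝ≥0 using hη.le
  obtain ⟨ν, hν, hνμ⟩ := exists_isFiniteMeasure_lintegral_le μ (η := η) hη
  refine ⟨ν, hν, fun h h' hh hle => ?_⟩
  have h1 : ‖φ h'‖ₑ ≤ η := (hφ h').trans ((lintegral_mono fun x =>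
    enorm_le_iff_norm_le.2 (hle x)).trans (hνμ (fun x => ‖h x‖ₑ) hh))
  exact ENNReal.coe_le_coe.1 h1

/-- Every finite measure admits a member of `A` which is large at some function `u * k`, `‖k‖ ≤ 1`,
that is small in the `L²`-seminorm of the measure. -/
def IsSingularlyLarge (A : Set (StrongDual 𝕜 C₀(Ω, 𝕜))) (δ : ℝ) (u : Ω →ᵇ ℝ) : Prop :=
  ∀ μ : Measure Ω, IsFiniteMeasure μ → ∃ φ ∈ A, ∃ k : C₀(Ω, 𝕜), ‖k‖ ≤ 1 ∧
    ∫⁻ x, ‖bmul u k x‖ₑ ^ 2 ∂μ ≤ 1 ∧ δ < ‖φ (bmul u k)‖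

variable {A : Set (StrongDual 𝕜 C₀(Ω, 𝕜))} {δ : ℝ} {u : Ω →ᵇ ℝ}

/-- Add a new k and damp the old gᵢ to (1 - |k|)gᵢ, which keeps the sum of moduli at most 1. The
loss u|k|gᵢ is dominated by |uk|, so choosing k small for all the measures attached to the φᵢ costs
each at most half its surplus over δ. -/
theorem IsSingularlyLarge.exists_family [T2Space Ω] [LocallyCompactSpace Ω]
    (hA : IsSingularlyLarge A δ u) (N : ℕ) :
    ∃ g : Fin N → C₀(Ω, 𝕜), (∀ x, ∑ i, ‖g i x‖ ≤ 1) ∧ ∀ i, ∃ φ ∈ A, δ < ‖φ (bmul u (g i))‖ := by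
  induction N with
  | zero => exact ⟨fun _ => 0, fun x => by simp, fun i => i.elim0⟩
  | succ N ih =>
    obtain ⟨g, hg, hφ⟩ := ih
    choose φ hφA hφg using hφ
    choose ν hν hνφ using fun i => exists_isFiniteMeasure_norm_apply_le (φ i)
      (half_pos (sub_pos.2 (hφg i)))
    obtain ⟨ψ, hψ, k, hk, hint, hlarge⟩ := hA (∑ i, ν i) inferInstance
    have hkx : ∀ x, ‖k x‖ ≤ 1 := fun x => (norm_apply_le_norm k x).trans hk
    refine ⟨Fin.cons k fun i => bmul (oneSubNorm k) (g i), fun x => ?_, fun i => ?_⟩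
    · rw [Fin.sum_univ_succ]
      simp only [Fin.cons_zero, Fin.cons_succ, bmul_apply, oneSubNorm_apply, norm_smul]
      rw [← Finset.mul_sum, Real.norm_of_nonneg (sub_nonneg.2 (hkx x))]
      nlinarith [hg x, hkx x]
    · refine Fin.cases ⟨ψ, hψ, by simpa using hlarge⟩ (fun i => ⟨φ i, hφA i, ?_⟩) i
      simp only [Fin.cons_succ]
      have hsmall : ‖φ i (bmul u (g i) - bmul u (bmul (oneSubNorm k) (g i)))‖
          ≤ (‖φ i (bmul u (g i))‖ - δ) / 2 := by
        refine hνφ i (bmul u k) _ (le_trans ?_ hint) fun x => ?_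
        · rw [lintegral_finsetSum_measure]
          exact Finset.single_le_sum (f := fun i => ∫⁻ x, ‖bmul u k x‖ₑ ^ 2 ∂ν i)
            (fun _ _ => zero_le) (Finset.mem_univ i)
        · have hgx : ‖g i x‖ ≤ 1 := (Finset.single_le_sum (f := fun i => ‖g i x‖)
            (fun _ _ => norm_nonneg _) (Finset.mem_univ i)).trans (hg x)
          have : (bmul u (g i) - bmul u (bmul (oneSubNorm k) (g i))) x
              = (u x * ‖k x‖) • g i x := by
            simp only [ZeroAtInftyContinuousMap.sub_apply, bmul_apply, oneSubNorm_apply,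
              smul_smul, ← sub_smul]
            congr 1; ring
          rw [this, bmul_apply, norm_smul, norm_smul, norm_mul, norm_norm]
          exact mul_le_of_le_one_right (by positivity) hgx
      rw [map_sub] at hsmall
      have h1 := norm_sub_norm_le (φ i (bmul u (g i))) (φ i (bmul u (bmul (oneSubNorm k) (g i))))
      linarith [hφg i]

/-- One step of the construction of a disjoint-like sequence. -/
theorem IsSingularlyLarge.exists_step [T2Space Ω] [LocallyCompactSpace Ω]
    (hA : IsSingularlyLarge A δ u) {M : ℝ} (hM : ∀ φ ∈ A, ‖φ‖ ≤ M) (hu0 : ∀ x, 0 ≤ u x)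
    (hu1 : ∀ x, u x ≤ 1) {δ' : ℝ} (hδ : δ' < δ) :
    ∃ g : C₀(Ω, 𝕜), ‖g‖ ≤ 1 ∧ (∃ φ ∈ A, δ' < ‖φ (bmul u g)‖) ∧
      IsSingularlyLarge A δ' (u * oneSubNorm g) := by
  obtain ⟨N, hN⟩ := exists_nat_gt (M / (δ - δ'))
  rw [div_lt_iff₀ (sub_pos.2 hδ)] at hN
  obtain ⟨g, hg, hφ⟩ := hA.exists_family N
  have hgx : ∀ i x, ‖g i x‖ ≤ 1 := fun i x => (Finset.single_le_sum (f := fun i => ‖g i x‖)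
    (fun _ _ => norm_nonneg _) (Finset.mem_univ i)).trans (hg x)
  suffices h : ∃ i, IsSingularlyLarge A δ' (u * oneSubNorm (g i)) by
    obtain ⟨i, hi⟩ := h
    obtain ⟨φ, hφA, hφi⟩ := hφ i
    exact ⟨g i, norm_le_of_forall_apply zero_le_one (hgx i), ⟨φ, hφA, hδ.trans hφi⟩, hi⟩
  by_contra! hcon
  simp only [IsSingularlyLarge] at hcon
  push Not at hcon
  choose ν hν hνφ using hcon
  -- If every i fails, one pair (φ, k) tested on the summed measure witnesses all failures:
  -- |φ(u|gᵢ|k)| ≥ δ - δ' for each i. These N values sum to at most ‖φ‖ ≤ M, against the choice of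
  -- N.
  obtain ⟨φ, hφA, k, hk, hint, hlarge⟩ := hA (∑ i, ν i) inferInstance
  have hkx : ∀ x, ‖k x‖ ≤ 1 := fun x => (norm_apply_le_norm k x).trans hk
  have hsmall : ∀ i, ‖φ (bmul (u * oneSubNorm (g i)) k)‖ ≤ δ' := fun i => by
    refine hνφ i φ hφA k hk (le_trans ?_ hint)
    rw [lintegral_finsetSum_measure]
    refine le_trans (lintegral_mono fun x => ?_)
      (Finset.single_le_sum (f := fun i => ∫⁻ x, ‖bmul u k x‖ₑ ^ 2 ∂ν i)
        (fun _ _ => zero_le) (Finset.mem_univ i))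
    gcongr
    refine enorm_le_iff_norm_le.2 ?_
    simp only [bmul_apply, BoundedContinuousFunction.coe_mul, Pi.mul_apply, oneSubNorm_apply,
      norm_smul, norm_mul]
    refine mul_le_mul_of_nonneg_right (mul_le_of_le_one_right (norm_nonneg _) ?_) (norm_nonneg _)
    rw [Real.norm_of_nonneg (sub_nonneg.2 (hgx i x))]
    linarith [norm_nonneg (g i x)]
  have hsum := sum_norm_apply_le Finset.univ φ
    (fun i => bmul u k - bmul (u * oneSubNorm (g i)) k) (fun x => by
      refine le_trans (Finset.sum_le_sum fun i _ => ?_) (hg x)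
      have : (bmul u k - bmul (u * oneSubNorm (g i)) k) x = (u x * ‖g i x‖) • k x := by
        simp only [ZeroAtInftyContinuousMap.sub_apply, bmul_apply, oneSubNorm_apply,
          BoundedContinuousFunction.coe_mul, Pi.mul_apply, ← sub_smul]
        congr 1; ring
      rw [this, norm_smul, norm_mul, norm_norm, Real.norm_of_nonneg (hu0 x), mul_assoc]
      refine (mul_le_of_le_one_left (by positivity) (hu1 x)).trans ?_
      exact mul_le_of_le_one_right (norm_nonneg _) (hkx x))
  have hlow : (N : ℝ) * (δ - δ') ≤ ∑ i, ‖φ (bmul u k - bmul (u * oneSubNorm (g i)) k)‖ := by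
    have : (N : ℝ) * (δ - δ') = ∑ _i : Fin N, (δ - δ') := by
      rw [Finset.sum_const, Finset.card_univ, Fintype.card_fin, nsmul_eq_mul]
    rw [this]
    refine Finset.sum_le_sum fun i _ => ?_
    rw [map_sub]
    have := norm_sub_norm_le (φ (bmul u k)) (φ (bmul (u * oneSubNorm (g i)) k))
    linarith [hsmall i]
  linarith [hM φ hφA]

theorem IsSingularlyLarge.exists_seq [T2Space Ω] [LocallyCompactSpace Ω]
    (hA : IsSingularlyLarge A δ 1) {M : ℝ} (hM : ∀ φ ∈ A, ‖φ‖ ≤ M) {δ' : ℝ} (hδ : δ' < δ) :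
    ∃ f : ℕ → C₀(Ω, 𝕜), (∀ n x, ∑ i ∈ Finset.range n, ‖f i x‖ ≤ 1) ∧
      ∀ n, ∃ φ ∈ A, δ' < ‖φ (f n)‖ := by
  -- Each step lowers the level; asking only for some level above δ' lets the recursion continue
  -- indefinitely.
  let S := {u : Ω →ᵇ ℝ // (∀ x, 0 ≤ u x) ∧ (∀ x, u x ≤ 1) ∧ ∃ d, δ' < d ∧ IsSingularlyLarge A d u}
  have hstep : ∀ s : S, ∃ g : C₀(Ω, 𝕜), ‖g‖ ≤ 1 ∧ (∃ φ ∈ A, δ' < ‖φ (bmul s.1 g)‖) ∧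
      ∃ t : S, t.1 = s.1 * oneSubNorm g := by
    rintro ⟨u, hu0, hu1, d, hd, hud⟩
    obtain ⟨e, he, hed⟩ := exists_between hd
    obtain ⟨g, hg, ⟨φ, hφ, hφg⟩, hlarge⟩ := hud.exists_step hM hu0 hu1 hed
    have hgx : ∀ x, ‖g x‖ ≤ 1 := fun x => (norm_apply_le_norm g x).trans hg
    refine ⟨g, hg, ⟨φ, hφ, he.trans hφg⟩, ⟨_, fun x => ?_, fun x => ?_, e, he, hlarge⟩, rfl⟩
    · exact mul_nonneg (hu0 x) (sub_nonneg.2 (hgx x))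
    · refine mul_le_one₀ (hu1 x) (sub_nonneg.2 (hgx x)) ?_
      change 1 - ‖g x‖ ≤ 1
      linarith [norm_nonneg (g x)]
  choose g hg hφ t ht using hstep
  let s : ℕ → S := fun n => Nat.rec
    ⟨1, fun x => zero_le_one, fun x => le_rfl, δ, hδ, hA⟩ (fun _ s => t s) n
  refine ⟨fun n => bmul (s n).1 (g (s n)), fun n x => ?_, fun n => hφ (s n)⟩
  -- The sum telescopes, because uᵢ|gᵢ| = uᵢ - uᵢ₊₁.
  have hsum : ∀ n, ∑ i ∈ Finset.range n, ‖bmul (s i).1 (g (s i)) x‖ = 1 - (s n).1 x := fun n => by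
    induction n with
    | zero => simp [s]
    | succ n ih =>
      have h1 : (s (n + 1)).1 = (s n).1 * oneSubNorm (g (s n)) := ht (s n)
      rw [Finset.sum_range_succ, ih, h1, bmul_apply, norm_smul,
        Real.norm_of_nonneg ((s n).2.1 x), BoundedContinuousFunction.coe_mul, Pi.mul_apply,
        oneSubNorm_apply]
      ring
  rw [hsum n]
  linarith [(s n).2.1 x]

/-- The canonical map from `C₀(Ω, 𝕜)` to the `L²`-space of a finite measure. -/
noncomputable def toL2 (𝕜 : Type*) [RCLike 𝕜] (μ : Measure Ω) [IsFiniteMeasure μ] :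
    C₀(Ω, 𝕜) →L[𝕜] Lp 𝕜 2 μ :=
  (BoundedContinuousFunction.toLp 2 μ 𝕜).comp
    ({ toFun := fun f : C₀(Ω, 𝕜) => f.toBCF
       map_add' := fun _ _ => rfl
       map_smul' := fun _ _ => rfl
       cont := ZeroAtInftyContinuousMap.isometry_toBCF.continuous } : C₀(Ω, 𝕜) →L[𝕜] Ω →ᵇ 𝕜)

theorem lintegral_enorm_sq_eq_enorm_toL2 (μ : Measure Ω) [IsFiniteMeasure μ] (f : C₀(Ω, 𝕜)) :
    ∫⁻ x, ‖f x‖ₑ ^ 2 ∂μ = ‖toL2 𝕜 μ f‖ₑ ^ 2 := by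
  have h1 : eLpNorm (toL2 𝕜 μ f) 2 μ = eLpNorm f 2 μ :=
    eLpNorm_congr_ae (BoundedContinuousFunction.coeFn_toLp 2 μ 𝕜 f.toBCF)
  have h2 := eLpNorm_nnreal_pow_eq_lintegral (μ := μ) (f := f) (p := 2) two_ne_zero
  rw [Lp.enorm_def, h1]
  simpa using h2.symm

theorem isSingularlyLarge_one {M : ℝ} (hM : ∀ φ ∈ A, ‖φ‖ ≤ M) (hδ : 0 < δ)
    (hA : ∀ K : Set (StrongDual 𝕜 C₀(Ω, 𝕜)), K.Nonempty → IsWeaklyCompact 𝕜 K →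
      ∃ φ ∈ A, ENNReal.ofReal δ < Metric.infEDist φ K) :
    IsSingularlyLarge A δ 1 := by
  intro μ _
  -- R ≥ M ensures that R‖k‖₂ < |φ(k)| ≤ M forces ‖k‖₂ < 1; the 1 keeps R positive.
  set R : ℝ := max M 1 with hR
  have hR0 : 0 < R := lt_max_of_lt_right one_pos
  obtain ⟨φ, hφ, hdist⟩ := hA _ ((Metric.nonempty_closedBall.2 hR0.le).image _)
    (isWeaklyCompact_image_comp_closedBall (toL2 𝕜 μ) R)
  obtain ⟨h, hh⟩ : ∃ h, δ * ‖h‖ + R * ‖toL2 𝕜 μ h‖ < ‖φ h‖ := by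
    by_contra! hcon
    obtain ⟨ψ, hψ, hd⟩ := exists_decomposition_of_norm_le_add (toL2 𝕜 μ) hδ hR0.le φ hcon
    refine hdist.not_ge ((Metric.infEDist_le_edist_of_mem
      (Set.mem_image_of_mem _ (mem_closedBall_zero_iff.2 hψ))).trans ?_)
    rw [edist_eq_enorm_sub, ← ofReal_norm]
    exact ENNReal.ofReal_le_ofReal hd
  have hh0 : 0 < ‖h‖ := by
    rw [norm_pos_iff]; rintro rfl; simp at hh
  set c : 𝕜 := ((‖h‖⁻¹ : ℝ) : 𝕜) with hc
  have hcn : ‖c‖ = ‖h‖⁻¹ := by simp [hc]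
  have hk : ‖c • h‖ = 1 := by rw [norm_smul, hcn, inv_mul_cancel₀ hh0.ne']
  have hkey : δ + R * ‖toL2 𝕜 μ (c • h)‖ < ‖φ (c • h)‖ := by
    rw [map_smul, map_smul, norm_smul, norm_smul, hcn]
    have := mul_lt_mul_of_pos_left hh (inv_pos.2 hh0)
    refine lt_of_eq_of_lt ?_ this
    field_simp
  have hone : bmul 1 (c • h) = c • h := by ext x; simp
  refine ⟨φ, hφ, c • h, hk.le, ?_, ?_⟩
  · rw [hone, lintegral_enorm_sq_eq_enorm_toL2]
    refine pow_le_one₀ zero_le ?_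
    rw [← ofReal_norm, ← ENNReal.ofReal_one]
    refine ENNReal.ofReal_le_ofReal ?_
    have h1 : ‖φ (c • h)‖ ≤ R := by
      have := φ.le_opNorm (c • h)
      rw [hk, mul_one] at this
      exact this.trans ((hM φ hφ).trans (le_max_left _ _))
    by_contra! hlt
    nlinarith
  · rw [hone]
    exact lt_of_le_of_lt (le_add_of_nonneg_right (by positivity)) hkey

end DisjointSequences

/-! ### The quantitative property (V). -/

section PropertyV

open scoped NNReal BoundedContinuousFunction

variable {𝕜 : Type*} [RCLike 𝕜] {Ω : Type*} [TopologicalSpace Ω] {Y : Type*}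
  [NormedAddCommGroup Y] [NormedSpace 𝕜 Y]

theorem isNormalizedWUC_of_sum_norm_le {f : ℕ → C₀(Ω, 𝕜)}
    (hf : ∀ n x, ∑ i ∈ Finset.range n, ‖f i x‖ ≤ 1) : IsNormalizedWUC 𝕜 f := by
  refine iSup₂_le fun φ hφ => ?_
  rw [ENNReal.tsum_eq_iSup_nat]
  refine iSup_le fun n => ?_
  have h := (sum_norm_apply_le (Finset.range n) φ f (hf n)).trans
    (mem_closedBall_zero_iff.1 hφ)
  simp_rw [← ofReal_norm]
  rw [← ENNReal.ofReal_sum_of_nonneg fun _ _ => norm_nonneg _]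
  simpa using ENNReal.ofReal_le_ofReal h

theorem le_uc_of_forall_le_enorm {X : Type*} [NormedAddCommGroup X] [NormedSpace 𝕜 X]
    (T : X →L[𝕜] Y) {f : ℕ → X} (hf : IsNormalizedWUC 𝕜 f) {c : ℝ≥0∞} (hc : ∀ n, c ≤ ‖T (f n)‖ₑ) :
    c ≤ uc T := by
  refine le_trans (le_iInf fun n => ?_) (le_iSup₂_of_le f hf le_rfl)
  -- Partial sum n ends with the term of index n, so partial sums n + 1 and n differ by T(f (n +
  -- 1)).
  refine (hc (n + 1)).trans ?_
  refine le_iSup_of_le (n + 1) (le_iSup_of_le n (le_iSup_of_le (Nat.le_succ n)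
    (le_iSup_of_le le_rfl ?_)))
  beta_reduce
  rw [Finset.sum_range_succ _ (n + 1), add_sub_cancel_left]

/-- The quantitative property (V) of `C₀(Ω, 𝕜)`, with constant one. -/
theorem omega_dualOp_le_uc [T2Space Ω] [LocallyCompactSpace Ω] (T : C₀(Ω, 𝕜) →L[𝕜] Y) :
    omega (dualOp T) ≤ uc T := by
  refine ENNReal.le_of_forall_nnreal_lt fun r hr => ?_
  -- The gap between r and d is what the construction of the sequence consumes.
  obtain ⟨d, hrd, hd⟩ := ENNReal.lt_iff_exists_nnreal_btwn.1 hr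
  rw [ENNReal.coe_lt_coe] at hrd
  borelize Ω
  set A := dualOp T '' Metric.closedBall 0 1 with hA
  have hAdef : ∀ φ ∈ A, ∃ g : StrongDual 𝕜 Y, ‖g‖ ≤ 1 ∧ g.comp T = φ := by
    rintro _ ⟨g, hg, rfl⟩
    exact ⟨g, by simpa using hg, rfl⟩
  have hM : ∀ φ ∈ A, ‖φ‖ ≤ ‖T‖ := fun φ hφ => by
    obtain ⟨g, hg, rfl⟩ := hAdef φ hφ
    exact (g.opNorm_comp_le T).trans (mul_le_of_le_one_left (norm_nonneg _) hg)
  have hlarge : IsSingularlyLarge A d 1 := by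
    refine isSingularlyLarge_one hM (lt_of_le_of_lt r.coe_nonneg (by exact_mod_cast hrd))
      fun K hne hK => ?_
    have h1 : (d : ℝ≥0∞) < excess A K := hd.trans_le (iInf₂_le_of_le K hne (iInf_le _ hK))
    obtain ⟨φ, hφ⟩ := lt_iSup_iff.1 h1
    obtain ⟨hφA, hφd⟩ := lt_iSup_iff.1 hφ
    exact ⟨φ, hφA, by rwa [ENNReal.ofReal_coe_nnreal]⟩
  obtain ⟨f, hf, hfφ⟩ := hlarge.exists_seq hM (δ' := r) (by exact_mod_cast hrd)
  refine le_uc_of_forall_le_enorm T (isNormalizedWUC_of_sum_norm_le hf) fun n => ?_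
  obtain ⟨φ, hφ, hlt⟩ := hfφ n
  obtain ⟨g, hg, rfl⟩ := hAdef φ hφ
  have h1 : ‖g (T (f n))‖ ≤ ‖T (f n)‖ :=
    (g.le_opNorm _).trans (mul_le_of_le_one_left (norm_nonneg _) hg)
  exact ENNReal.coe_le_coe.2 (hlt.le.trans h1)

theorem hasQuantVOmegaStar_zeroAtInfty [T2Space Ω] [LocallyCompactSpace Ω] :
    HasQuantVOmegaStar.{v} 𝕜 C₀(Ω, 𝕜) :=
  ⟨1, one_pos, fun Y _ _ _ T => by simpa using omega_dualOp_le_uc T⟩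

theorem hasQuantV_zeroAtInfty [T2Space Ω] [LocallyCompactSpace Ω] :
    HasQuantV.{v} 𝕜 C₀(Ω, 𝕜) :=
  ⟨2, two_pos, fun Y _ _ _ T => by
    simpa using (gamma_le_two_mul_omega_dualOp T).trans
      (mul_le_mul_right (omega_dualOp_le_uc T) 2)⟩

end PropertyV

end QuantV

theorem theorem4p1 (Ω : Type u) [TopologicalSpace Ω] [T2Space Ω] [LocallyCompactSpace Ω] :
    -- complex scalars
    ((∀ (Y : Type v) [NormedAddCommGroup Y] [NormedSpace ℂ Y] [CompleteSpace Y]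
        (T : C₀(Ω, ℂ) →L[ℂ] Y),
        QuantV.omega (QuantV.dualOp T) ≤ ENNReal.ofReal Real.pi * QuantV.uc T) ∧
      QuantV.HasQuantVOmegaStar.{v} ℂ C₀(Ω, ℂ) ∧
      QuantV.HasQuantV.{v} ℂ C₀(Ω, ℂ)) ∧
    -- real scalars
    ((∀ (Y : Type v) [NormedAddCommGroup Y] [NormedSpace ℝ Y] [CompleteSpace Y]
        (T : C₀(Ω, ℝ) →L[ℝ] Y),
        QuantV.omega (QuantV.dualOp T) ≤ 2 * QuantV.uc T) ∧
      QuantV.HasQuantVOmegaStar.{v} ℝ C₀(Ω, ℝ) ∧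
      QuantV.HasQuantV.{v} ℝ C₀(Ω, ℝ)) := by
  refine ⟨⟨fun Y _ _ _ T => ?_, QuantV.hasQuantVOmegaStar_zeroAtInfty,
    QuantV.hasQuantV_zeroAtInfty⟩, fun Y _ _ _ T => ?_, QuantV.hasQuantVOmegaStar_zeroAtInfty,
    QuantV.hasQuantV_zeroAtInfty⟩
  -- Constant one suffices, so only 1 ≤ π is needed here and 1 ≤ 2 in the real case.
  · refine (QuantV.omega_dualOp_le_uc T).trans (le_mul_of_one_le_left zero_le ?_)
    rw [ENNReal.one_le_ofReal]
    linarith [Real.pi_gt_three]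
  · exact (QuantV.omega_dualOp_le_uc T).trans (le_mul_of_one_le_left zero_le one_le_two)
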